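/- Let $\Omega\subset\mathbb{C}^n$ be a domain (a non-empty connected open set) and let $\varphi:\Omega\to[-\infty,+\infty)$ be an upper semicontinuous function. Put $\mathrm{Pole}(\varphi)=\varphi^{-1}(-\infty)$. Assume that $\mathrm{Pole}(\varphi)$ is closed in $\Omega$ and that $\varphi$ is locally Hölder continuous on $\Omega\setminus\mathrm{Pole}(\varphi)$, i.e. for every open $\Omega'\Subset\Omega\setminus\mathrm{Pole}(\varphi)$ there are constants $a=a_{\Omega'}\in(0,1]$ and $C=C_{\Omega'}>0$ such that $|\varphi(z)-\varphi(w)|\le C|z-w|^{a}$ for all $z,w\in\Omega'$. Assume moreover that $(\Omega,\varphi)$ satisfies the twisted Hörmander condition: for every positive integer $m$, every smooth strictly plurisubharmonic function $\psi$ on $\Omega$ (that is, a smooth $\psi:\Omega\to\mathbb{R}$ whose complex Hessian $(\partial^2\psi/\partial z_j\partial\bar z_k)_{j,k}$ is positive definite at every point), and every smooth $\bar\partial$-closed $(0,1)$-form $\alpha=\sum_j\alpha_j\,d\bar z_j$ with compact support in $\Omega$ and $$\int_\Omega|\alpha|^2_{\sqrt{-1}\partial\bar\partial\psi}\,e^{-(m\varphi+\psi)}<+\infty,$$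 there exists a smooth function $u:\Omega\to\mathbb{C}$ such that $\bar\partial u=\alpha$ on $\Omega$ and $$\int_\Omega|u|^2e^{-(m\varphi+\psi)}\le\int_\Omega|\alpha|^2_{\sqrt{-1}\partial\bar\partial\psi}\,e^{-(m\varphi+\psi)}.$$ Here integrals are with respect to Lebesgue measure, $e^{-(m\varphi+\psi)}=+\infty$ on $\mathrm{Pole}(\varphi)$, $0\cdot(+\infty)=0$, and $|\alpha|^2_{\sqrt{-1}\partial\bar\partial\psi}=\sum_{j,k}(H^{-1})_{jk}\,\alpha_j\overline{\alpha_k}$ with $H=(\partial^2\psi/\partial z_j\partial\bar z_k)_{j,k}$. Then $\varphi$ is plurisubharmonic on $\Omega$: it is upper semicontinuous with values in $[-\infty,+\infty)$, and $$\varphi(a)\le\frac1{2\pi}\int_0^{2\pi}\varphi(a+e^{i\theta}b)\,d\theta$$ for all $a,b\in\mathbb{C}^n$ such that $a+\zeta b\in\Omega$ for every $\zeta\in\mathbb{C}$ with $|\zeta|\le1$. (The function $\varphi\equiv-\infty$ counts as plurisubharmonic.) -/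

import Mathlib

open Set MeasureTheory
open scoped ENNReal ContDiff

namespace TwistedHormander

/-- The space `ℂⁿ` with its Euclidean norm (and Lebesgue measure as `volume`). -/
abbrev Cn (n : ℕ) : Type := EuclideanSpace ℂ (Fin n)

/-- The `j`-th standard basis vector of `ℂⁿ`. -/
noncomputable def basisVec {n : ℕ} (j : Fin n) : Cn n := EuclideanSpace.single j (1 : ℂ)

/-- The Wirtinger derivative `∂f/∂z_j = (1/2) (∂f/∂x_j - i ∂f/∂y_j)`. -/
noncomputable def dz {n : ℕ} (j : Fin n) (f : Cn n → ℂ) (z : Cn n) : ℂ :=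
  (1 / 2 : ℂ) *
    (fderiv ℝ f z (basisVec j) - Complex.I * fderiv ℝ f z (Complex.I • basisVec j))

/-- The Wirtinger derivative `∂f/∂z̄_j = (1/2) (∂f/∂x_j + i ∂f/∂y_j)`. -/
noncomputable def dzbar {n : ℕ} (j : Fin n) (f : Cn n → ℂ) (z : Cn n) : ℂ :=
  (1 / 2 : ℂ) *
    (fderiv ℝ f z (basisVec j) + Complex.I * fderiv ℝ f z (Complex.I • basisVec j))

/-- The complex Hessian `(∂²ψ/∂z_j∂z̄_k)_{j,k}`, i.e. the coefficient matrix of `i∂∂̄ψ`. -/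
noncomputable def complexHessian {n : ℕ} (ψ : Cn n → ℝ) (z : Cn n) :
    Matrix (Fin n) (Fin n) ℂ :=
  Matrix.of fun j k => dz j (dzbar k fun w => (ψ w : ℂ)) z

open scoped ComplexOrder in
/-- `ψ` is a smooth strictly plurisubharmonic function on the open set `Ω`. -/
def SmoothStrictlyPSH {n : ℕ} (Ω : Set (Cn n)) (ψ : Cn n → ℝ) : Prop :=
  ContDiffOn ℝ ∞ ψ Ω ∧ ∀ z ∈ Ω, (complexHessian ψ z).PosDef

/-- `α = ∑ⱼ αⱼ dz̄ⱼ` (given by its coefficient functions, extended by zero outside `Ω`) is a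
smooth `∂̄`-closed `(0,1)`-form with compact support in `Ω`. -/
structure IsTestForm {n : ℕ} (Ω : Set (Cn n)) (α : Fin n → Cn n → ℂ) : Prop where
  smooth : ∀ j, ContDiff ℝ ∞ (α j)
  compact_support : ∀ j, HasCompactSupport (α j)
  support_subset : ∀ j, tsupport (α j) ⊆ Ω
  dbar_closed : ∀ j k z, dzbar j (α k) z = dzbar k (α j) z

/-- The pointwise norm `|α|²_{i∂∂̄ψ} = ∑_{j,k} (H⁻¹)_{jk} α_j \overline{α_k}` at `z`, where
`H` is the complex Hessian of `ψ` at `z`. It is a nonnegative real number where `H` is positive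
definite. For `ψ = |z|²` it is `∑ⱼ |αⱼ|²`. -/
noncomputable def formNormSq {n : ℕ} (ψ : Cn n → ℝ) (α : Fin n → Cn n → ℂ) (z : Cn n) : ℝ :=
  (∑ j, ∑ k, (complexHessian ψ z)⁻¹ j k * α j z * star (α k z)).re

/-- The weight `e^{-(mφ+ψ)}`, with value `+∞` where `φ = -∞`. -/
noncomputable def weight {n : ℕ} (m : ℕ) (φ : Cn n → EReal) (ψ : Cn n → ℝ) (z : Cn n) :
    ℝ≥0∞ :=
  EReal.exp (-((m : EReal) * φ z + (ψ z : EReal)))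

/-- The twisted Hörmander condition for `(Ω, φ)`. -/
def TwistedHormanderCondition {n : ℕ} (Ω : Set (Cn n)) (φ : Cn n → EReal) : Prop :=
  ∀ m : ℕ, 0 < m → ∀ ψ : Cn n → ℝ, SmoothStrictlyPSH Ω ψ →
    ∀ α : Fin n → Cn n → ℂ, IsTestForm Ω α →
      (∫⁻ z in Ω, ENNReal.ofReal (formNormSq ψ α z) * weight m φ ψ z) < ⊤ →
      ∃ u : Cn n → ℂ, ContDiffOn ℝ ∞ u Ω ∧
        (∀ z ∈ Ω, ∀ j, dzbar j u z = α j z) ∧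
        (∫⁻ z in Ω, ENNReal.ofReal (‖u z‖ ^ 2) * weight m φ ψ z) ≤
          ∫⁻ z in Ω, ENNReal.ofReal (formNormSq ψ α z) * weight m φ ψ z

/-- The pole set `φ⁻¹(-∞)` of a function on `Ω`. -/
def pole {n : ℕ} (Ω : Set (Cn n)) (φ : Cn n → EReal) : Set (Cn n) :=
  {z ∈ Ω | φ z = ⊥}

/-- `φ` is locally Hölder continuous on `Ω` minus its poles: on every open set which is
relatively compact there it satisfies a Hölder estimate with some exponent in `(0,1]`. -/
def LocallyHolderOffPoles {n : ℕ} (Ω : Set (Cn n)) (φ : Cn n → EReal) : Prop :=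
  ∀ Ω' : Set (Cn n), IsOpen Ω' → IsCompact (closure Ω') → closure Ω' ⊆ Ω \ pole Ω φ →
    ∃ a C : ℝ, 0 < a ∧ a ≤ 1 ∧ 0 < C ∧
      ∀ z ∈ Ω', ∀ w ∈ Ω', |(φ z).toReal - (φ w).toReal| ≤ C * ‖z - w‖ ^ a

/-- The mean `(1/2π) ∫₀^{2π} f(θ) dθ ∈ [-∞,∞]` of an extended-real function, as the mean of the
positive part minus the mean of the negative part. It is the usual mean whenever `f` is
measurable and bounded above; it may be `-∞`. -/
noncomputable def circleMean (f : ℝ → EReal) : EReal :=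
  (((ENNReal.ofReal (2 * Real.pi))⁻¹ *
      ∫⁻ θ in Ioc 0 (2 * Real.pi), (f θ).toENNReal : ℝ≥0∞) : EReal) -
    (((ENNReal.ofReal (2 * Real.pi))⁻¹ *
      ∫⁻ θ in Ioc 0 (2 * Real.pi), (-f θ).toENNReal : ℝ≥0∞) : EReal)

/-- `φ : Ω → [-∞,∞)` is plurisubharmonic: it is upper semicontinuous, and it satisfies the
sub-mean value inequality on every closed disc `{a + ζ b : |ζ| ≤ 1} ⊆ Ω` of every complex line.
The constant `-∞` is admitted. -/
structure IsPlurisubharmonic {n : ℕ} (Ω : Set (Cn n)) (φ : Cn n → EReal) : Prop where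
  lt_top : ∀ z ∈ Ω, φ z < ⊤
  usc : UpperSemicontinuousOn φ Ω
  submean : ∀ a b : Cn n, (∀ ζ : ℂ, ‖ζ‖ ≤ 1 → a + ζ • b ∈ Ω) →
    φ a ≤ circleMean fun θ => φ (a + Complex.exp (θ * Complex.I) • b)

end TwistedHormander

/-! Let φ(a) = c be finite and let b ≠ 0. The condition is used with large m to build a holomorphic
f that is not small at a but is controlled by φ on the circle a + e^{iθ}b. Cut off near a with X and
solve ∂̄u = ∂̄X with weight mφ + ψ, where ψ is a smoothing at scale δ of ‖z - a‖² + (n+1) log ‖z -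
a‖². Since i∂∂̄ψ ≥ 1 and ∂̄X lives on an annulus around a, the right side is at most C e^{-m(c-η)}
with C independent of m and δ. For δ small (depending on m) the near-singularity of ψ forces |u(a)|
≤ 1/2, so f = X - u has |f(a)| ≥ 1/2 (`exists_holomorphic_peak`).

Near the circle X vanishes. The sub-mean value property on balls of radius r there gives |f|² ≤
exp(E + m(h - c + η)), where h majorizes φ on those balls and E does not depend on m. Jensen's
inequality yields log(1/4) ≤ E + m(mean h - c + η). Letting m → ∞ and then η → 0 gives c ≤ mean h
(`mul_le_integral_of_le_on_balls`). Taking for h truncated suprema of φ over shrinking balls, which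
decrease to φ by upper semicontinuity, monotone convergence gives the claim. -/

namespace TwistedHormander

/-! ### Lower bounds for Hermitian matrices -/

open Matrix in
open scoped ComplexOrder in
/-- If `1 ≤ H` then `H⁻¹ ≤ 1` as Hermitian forms. -/
theorem re_sum_inv_le_sum_norm_sq {n : ℕ} {H : Matrix (Fin n) (Fin n) ℂ}
    (hH : (H - 1).PosSemidef) (c : Fin n → ℂ) :
    (∑ j, ∑ k, H⁻¹ j k * c j * star (c k)).re ≤ ∑ j, ‖c j‖ ^ 2 := by
  have hpd : H.PosDef := by
    simpa using Matrix.PosDef.one.posSemidef_add hH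
  have hdet : IsUnit H.det := (Matrix.isUnit_iff_isUnit_det H).1 hpd.isUnit
  -- The sum conjugates the factor with the column index, so it is the form of H⁻¹ at the conjugate
  -- of c.
  set b : Fin n → ℂ := star c with hb
  set y : Fin n → ℂ := H⁻¹ *ᵥ b with hy
  have hHy : H *ᵥ y = b := by
    rw [hy, Matrix.mulVec_mulVec, Matrix.mul_nonsing_inv _ hdet, Matrix.one_mulVec]
  have hsum : ∑ j, ∑ k, H⁻¹ j k * c j * star (c k) = star b ⬝ᵥ y := by
    simp only [hy, hb, dotProduct, mulVec, star_star, Pi.star_apply, Finset.mul_sum]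
    refine Finset.sum_congr rfl fun j _ => Finset.sum_congr rfl fun k _ => by ring
  have hnorm : ∀ v : Fin n → ℂ, (star v ⬝ᵥ v).re = ∑ j, ‖v j‖ ^ 2 := by
    intro v
    simp only [dotProduct, Pi.star_apply, Complex.re_sum]
    refine Finset.sum_congr rfl fun j _ => ?_
    rw [RCLike.star_def, ← Complex.normSq_eq_conj_mul_self, Complex.ofReal_re,
      Complex.normSq_eq_norm_sq]
  have hre : (star b ⬝ᵥ y).re = (star y ⬝ᵥ b).re := by
    have : star b ⬝ᵥ y = star (star y ⬝ᵥ b) := by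
      rw [Matrix.star_dotProduct]
    rw [this, RCLike.star_def, Complex.conj_re]
  -- With y = H⁻¹b, H ≥ 1 gives |y|² ≤ Re⟨y, b⟩; expanding |b - y|² ≥ 0 then gives Re⟨y, b⟩ ≤ |b|².
  have h1 : 0 ≤ (star y ⬝ᵥ b).re - ∑ j, ‖y j‖ ^ 2 := by
    have := hH.dotProduct_mulVec_nonneg y
    rw [Matrix.sub_mulVec, Matrix.one_mulVec, hHy, dotProduct_sub] at this
    have := (Complex.le_def.1 this).1
    rwa [Complex.zero_re, Complex.sub_re, hnorm y] at this
  have h2 : 0 ≤ (star (b - y) ⬝ᵥ (b - y)).re := by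
    rw [hnorm]; positivity
  have h3 : (star (b - y) ⬝ᵥ (b - y)).re
      = ∑ j, ‖c j‖ ^ 2 - 2 * (star y ⬝ᵥ b).re + ∑ j, ‖y j‖ ^ 2 := by
    rw [star_sub, sub_dotProduct, dotProduct_sub, dotProduct_sub]
    simp only [Complex.sub_re, hre, hnorm]
    simp only [hb, Pi.star_apply, norm_star]
    ring
  rw [hsum, hre]
  linarith

-- A rank-one perturbation of a scalar matrix: as q ≤ 0, Cauchy–Schwarz shows that the worst
-- direction is the conjugate of x, where H acts as p + q|x|². Hessians of radial functions have
-- this shape.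
open Matrix in
open scoped ComplexOrder in
theorem posSemidef_sub_one_of_entries {n : ℕ} {H : Matrix (Fin n) (Fin n) ℂ} (p q : ℝ)
    (x : Fin n → ℂ)
    (hH : ∀ j k, H j k = (if j = k then (p : ℂ) else 0) + q * (star (x j) * x k))
    (hq : q ≤ 0) (hpq : 1 ≤ p + q * ∑ j, ‖x j‖ ^ 2) : (H - 1).PosSemidef := by
  have hform : ∀ v : Fin n → ℂ, star v ⬝ᵥ ((H - 1) *ᵥ v) =
      (((p - 1) * ∑ j, ‖v j‖ ^ 2 + q * ‖∑ k, x k * v k‖ ^ 2 : ℝ) : ℂ) := by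
    intro v
    have e : H - 1 = ((p - 1 : ℝ) : ℂ) • (1 : Matrix (Fin n) (Fin n) ℂ)
        + (q : ℂ) • Matrix.vecMulVec (star x) x := by
      ext j k
      simp only [Matrix.sub_apply, hH, Matrix.add_apply, Matrix.smul_apply, Matrix.one_apply,
        Matrix.vecMulVec_apply, Pi.star_apply, smul_eq_mul]
      split_ifs <;> push_cast <;> ring
    rw [e, Matrix.add_mulVec, Matrix.smul_mulVec, Matrix.smul_mulVec, Matrix.one_mulVec,
      dotProduct_add, dotProduct_smul, dotProduct_smul, Matrix.vecMulVec_mulVec]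
    have h1 : star v ⬝ᵥ v = ((∑ j, ‖v j‖ ^ 2 : ℝ) : ℂ) := by
      simp only [dotProduct, Pi.star_apply]
      push_cast
      refine Finset.sum_congr rfl fun j _ => ?_
      rw [RCLike.star_def, ← Complex.normSq_eq_conj_mul_self, Complex.normSq_eq_norm_sq]
      push_cast; rfl
    have h2 : star v ⬝ᵥ (MulOpposite.op (x ⬝ᵥ v) • star x)
        = ((‖∑ k, x k * v k‖ ^ 2 : ℝ) : ℂ) := by
      rw [dotProduct_smul]
      have : star v ⬝ᵥ star x = star (x ⬝ᵥ v) := by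
        rw [Matrix.star_dotProduct_star]
      rw [this]
      simp only [MulOpposite.smul_eq_mul_unop, MulOpposite.unop_op]
      rw [RCLike.star_def, ← Complex.normSq_eq_conj_mul_self, Complex.normSq_eq_norm_sq]
      rfl
    rw [h1, h2]
    simp only [smul_eq_mul]
    push_cast; ring
  refine Matrix.PosSemidef.of_dotProduct_mulVec_nonneg ?_ ?_
  · ext j k
    simp only [Matrix.conjTranspose_apply, Matrix.sub_apply, hH, Matrix.one_apply, star_sub,
      star_add, star_mul', star_star]
    by_cases h : j = k
    · subst h; simp [mul_comm]
    · simp [h, Ne.symm h, mul_comm]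
  · intro v
    rw [hform]
    norm_cast
    have hcs : ‖∑ k, x k * v k‖ ^ 2 ≤ (∑ j, ‖x j‖ ^ 2) * ∑ j, ‖v j‖ ^ 2 := by
      refine le_trans ?_ (Finset.sum_mul_sq_le_sq_mul_sq Finset.univ _ _)
      gcongr
      refine (norm_sum_le _ _).trans (le_of_eq ?_)
      simp
    have hv : 0 ≤ ∑ j, ‖v j‖ ^ 2 := by positivity
    nlinarith [mul_le_mul_of_nonpos_left hcs hq, mul_nonneg (sub_nonneg.2 hpq) hv]

/-! ### Radial functions and the logarithmic weight -/

theorem real_inner_basisVec {n : ℕ} (x : Cn n) (j : Fin n) :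
    inner ℝ x (basisVec j) = (x j).re := by
  rw [PiLp.inner_apply, Finset.sum_eq_single j]
  · simp [basisVec, Complex.inner]
  · intro b _ hb; simp [basisVec, hb]
  · simp

theorem real_inner_I_smul_basisVec {n : ℕ} (x : Cn n) (j : Fin n) :
    inner ℝ x (Complex.I • basisVec j) = (x j).im := by
  rw [PiLp.inner_apply, Finset.sum_eq_single j]
  · simp [basisVec, Complex.inner]
  · intro b _ hb; simp [basisVec, hb]
  · simp

theorem dzbar_radial {n : ℕ} {g g1 : ℝ → ℝ} (hg : ∀ s, 0 ≤ s → HasDerivAt g (g1 s) s)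
    (a z : Cn n) (k : Fin n) :
    dzbar k (fun w => ((g (‖w - a‖ ^ 2) : ℝ) : ℂ)) z = g1 (‖z - a‖ ^ 2) * (z k - a k) := by
  have hs : HasFDerivAt (fun w : Cn n => ‖w - a‖ ^ 2) _ z :=
    ((hasFDerivAt_id z).sub_const a).norm_sq
  have h := ((hg _ (sq_nonneg ‖z - a‖)).comp_hasFDerivAt z hs)
  have h' := Complex.ofRealCLM.hasFDerivAt.comp z h
  have e : fderiv ℝ (fun w => ((g (‖w - a‖ ^ 2) : ℝ) : ℂ)) z = _ := h'.fderiv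
  rw [dzbar, e]
  simp only [ContinuousLinearMap.comp_apply, _root_.smul_apply, id,
    innerSL_apply_apply, ContinuousLinearMap.id_apply, real_inner_basisVec,
    real_inner_I_smul_basisVec, Complex.ofRealCLM_apply, smul_eq_mul, nsmul_eq_mul]
  apply Complex.ext <;> simp <;> ring

theorem complexHessian_radial {n : ℕ} {g g1 g2 : ℝ → ℝ}
    (hg : ∀ s, 0 ≤ s → HasDerivAt g (g1 s) s) (hg1 : ∀ s, 0 ≤ s → HasDerivAt g1 (g2 s) s)
    (a z : Cn n) (j k : Fin n) :
    complexHessian (fun w => g (‖w - a‖ ^ 2)) z j k =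
      (if j = k then (g1 (‖z - a‖ ^ 2) : ℂ) else 0)
        + g2 (‖z - a‖ ^ 2) * (star (z j - a j) * (z k - a k)) := by
  have e0 : (dzbar k fun w => ((g (‖w - a‖ ^ 2) : ℝ) : ℂ)) =
      fun w => (g1 (‖w - a‖ ^ 2) : ℂ) * (w k - a k) := by
    funext w; exact dzbar_radial hg a w k
  simp only [complexHessian, Matrix.of_apply, e0]
  have hs : HasFDerivAt (fun w : Cn n => ‖w - a‖ ^ 2) _ z :=
    ((hasFDerivAt_id z).sub_const a).norm_sq
  have h := ((hg1 _ (sq_nonneg ‖z - a‖)).comp_hasFDerivAt z hs)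
  have h' := Complex.ofRealCLM.hasFDerivAt.comp z h
  have hk : HasFDerivAt (fun w : Cn n => w k - a k) _ z :=
    ((PiLp.proj 2 (fun _ : Fin n => ℂ) k : Cn n →L[ℝ] ℂ).hasFDerivAt).sub_const (a k)
  have e : fderiv ℝ (fun w : Cn n => (g1 (‖w - a‖ ^ 2) : ℂ) * (w k - a k)) z = _ :=
    (h'.mul hk).fderiv
  rw [dz, e]
  by_cases hjk : j = k
  · subst hjk
    simp [real_inner_basisVec, real_inner_I_smul_basisVec]
    apply Complex.ext <;> simp [basisVec] <;> ring
  · simp [real_inner_basisVec, real_inner_I_smul_basisVec, hjk]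
    apply Complex.ext <;> simp [basisVec, Ne.symm hjk] <;> ring

/-- A strictly plurisubharmonic approximation of `‖z - a‖² + (n+1) log ‖z - a‖²`. -/
noncomputable def logWeight {n : ℕ} (a : Cn n) (δ : ℝ) (z : Cn n) : ℝ :=
  ‖z - a‖ ^ 2 + (n + 1) * Real.log (‖z - a‖ ^ 2 + δ ^ 2)

-- The term ‖z - a‖² contributes exactly the identity, and the logarithmic term is plurisubharmonic:
-- with s = ‖z - a‖², its radial direction still gives (n+1)δ²/(s + δ²)² ≥ 0. The bound is uniform
-- in δ.
open scoped ComplexOrder in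
theorem posSemidef_complexHessian_logWeight_sub_one {n : ℕ} (a : Cn n) {δ : ℝ} (hδ : 0 < δ)
    (z : Cn n) : (complexHessian (logWeight a δ) z - 1).PosSemidef := by
  have hpos : ∀ s : ℝ, 0 ≤ s → 0 < s + δ ^ 2 := fun s hs => by positivity
  refine posSemidef_sub_one_of_entries
    (1 + (n + 1) * (‖z - a‖ ^ 2 + δ ^ 2)⁻¹) (-(n + 1) * ((‖z - a‖ ^ 2 + δ ^ 2)⁻¹) ^ 2)
    (fun j => z j - a j) (fun j k => ?_) ?_ ?_
  · refine complexHessian_radial (g := fun s => s + (n + 1) * Real.log (s + δ ^ 2))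
      (g1 := fun s => 1 + (n + 1) * (s + δ ^ 2)⁻¹)
      (g2 := fun s => -(n + 1) * ((s + δ ^ 2)⁻¹) ^ 2) ?_ ?_ a z j k
    · intro s hs
      have h := ((hasDerivAt_id s).add_const (δ ^ 2)).log (hpos s hs).ne'
      rw [← one_div]
      exact (hasDerivAt_id s).fun_add (h.const_mul ((n : ℝ) + 1))
    · intro s hs
      have h := ((hasDerivAt_id s).add_const (δ ^ 2)).inv (hpos s hs).ne'
      have h2 := (h.const_mul ((n : ℝ) + 1)).const_add 1
      exact h2.congr_deriv (by rw [id, neg_div, one_div, inv_pow, mul_neg, neg_mul])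
  · have : 0 ≤ ((n : ℝ) + 1) * ((‖z - a‖ ^ 2 + δ ^ 2)⁻¹) ^ 2 := by positivity
    linarith
  · have hs : ∑ j, ‖z j - a j‖ ^ 2 = ‖z - a‖ ^ 2 := by
      rw [EuclideanSpace.norm_sq_eq]; rfl
    rw [hs]
    set s := ‖z - a‖ ^ 2 with hs'
    have hp := hpos s (by positivity)
    have : (n + 1) * (s + δ ^ 2)⁻¹ + -(n + 1) * ((s + δ ^ 2)⁻¹) ^ 2 * s
        = (n + 1) * δ ^ 2 * ((s + δ ^ 2)⁻¹) ^ 2 := by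
      field_simp; ring
    have h2 : 0 ≤ ((n : ℝ) + 1) * δ ^ 2 * ((s + δ ^ 2)⁻¹) ^ 2 := by positivity
    linarith

open scoped ComplexOrder in
theorem smoothStrictlyPSH_logWeight {n : ℕ} (Ω : Set (Cn n)) (a : Cn n) {δ : ℝ} (hδ : 0 < δ) :
    SmoothStrictlyPSH Ω (logWeight a δ) := by
  refine ⟨ContDiff.contDiffOn ?_, fun z _ => ?_⟩
  · have hs : ContDiff ℝ ∞ fun z : Cn n => ‖z - a‖ ^ 2 :=
      (contDiff_id.sub contDiff_const).norm_sq ℝ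
    exact hs.add (contDiff_const.mul ((hs.add contDiff_const).log fun z => by positivity))
  · simpa using Matrix.PosDef.one.posSemidef_add
      (posSemidef_complexHessian_logWeight_sub_one a hδ z)

/-- The right side does not involve δ, which frees δ to be chosen after m. -/
theorem formNormSq_logWeight_le {n : ℕ} (a : Cn n) {δ : ℝ} (hδ : 0 < δ)
    (α : Fin n → Cn n → ℂ) (z : Cn n) :
    formNormSq (logWeight a δ) α z ≤ ∑ j, ‖α j z‖ ^ 2 :=
  re_sum_inv_le_sum_norm_sq (posSemidef_complexHessian_logWeight_sub_one a hδ z) _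

/-! ### Calculus of ∂̄ and the Cauchy–Riemann equations -/

theorem contDiff_dzbar {n : ℕ} (j : Fin n) {f : Cn n → ℂ} (hf : ContDiff ℝ ∞ f) :
    ContDiff ℝ ∞ (dzbar j f) := by
  have h : ContDiff ℝ ∞ (fderiv ℝ f) := hf.fderiv_right (by simp)
  exact contDiff_const.mul ((h.clm_apply contDiff_const).add
    (contDiff_const.mul (h.clm_apply contDiff_const)))

theorem tsupport_dzbar_subset {n : ℕ} (j : Fin n) (f : Cn n → ℂ) :
    tsupport (dzbar j f) ⊆ tsupport f := by
  refine closure_minimal (fun z hz => ?_) (isClosed_tsupport f)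
  refine support_fderiv_subset ℝ (f := f) fun h => hz ?_
  simp only [dzbar, h]
  simp

theorem dzbar_comm {n : ℕ} (j k : Fin n) {f : Cn n → ℂ} (hf : ContDiff ℝ ∞ f) (z : Cn n) :
    dzbar j (dzbar k f) z = dzbar k (dzbar j f) z := by
  have hd : DifferentiableAt ℝ (fderiv ℝ f) z :=
    ((hf.fderiv_right (m := ∞) (by simp)).differentiable (by simp)) z
  have happ : ∀ v : Cn n, HasFDerivAt (fun w => fderiv ℝ f w v)
      ((ContinuousLinearMap.apply ℝ ℂ v).comp (fderiv ℝ (fderiv ℝ f) z)) z := fun v =>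
    (ContinuousLinearMap.apply ℝ ℂ v).hasFDerivAt.comp z hd.hasFDerivAt
  have hbar : ∀ (l : Fin n) (v : Cn n), fderiv ℝ (dzbar l f) z v = (1 / 2 : ℂ) *
      (fderiv ℝ (fderiv ℝ f) z v (basisVec l)
        + Complex.I * fderiv ℝ (fderiv ℝ f) z v (Complex.I • basisVec l)) := by
    intro l v
    have : HasFDerivAt (dzbar l f) _ z :=
      ((happ (basisVec l)).add ((happ (Complex.I • basisVec l)).const_mul
        Complex.I)).const_mul (1 / 2 : ℂ)
    rw [this.fderiv]
    simp only [_root_.add_apply, _root_.smul_apply, ContinuousLinearMap.comp_apply,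
      ContinuousLinearMap.apply_apply, smul_eq_mul]
  have hsym : IsSymmSndFDerivAt ℝ f z :=
    hf.contDiffAt.isSymmSndFDerivAt (by simp only [minSmoothness_of_isRCLikeNormedField]; exact WithTop.coe_le_coe.2 (le_top : (2 : ℕ∞) ≤ ⊤))
  rw [dzbar, dzbar, hbar, hbar, hbar, hbar, hsym (basisVec j) (basisVec k),
    hsym (basisVec j) (Complex.I • basisVec k), hsym (Complex.I • basisVec j) (basisVec k),
    hsym (Complex.I • basisVec j) (Complex.I • basisVec k)]
  ring

theorem isTestForm_dzbar {n : ℕ} {Ω : Set (Cn n)} {f : Cn n → ℂ} (hf : ContDiff ℝ ∞ f)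
    (hc : HasCompactSupport f) (hs : tsupport f ⊆ Ω) : IsTestForm Ω fun j => dzbar j f where
  smooth j := contDiff_dzbar j hf
  compact_support j := hc.mono' ((subset_tsupport _).trans (tsupport_dzbar_subset j f))
  support_subset j := (tsupport_dzbar_subset j f).trans hs
  dbar_closed j k z := dzbar_comm j k hf z

theorem dzbar_sub {n : ℕ} (j : Fin n) {f g : Cn n → ℂ} {z : Cn n}
    (hf : DifferentiableAt ℝ f z) (hg : DifferentiableAt ℝ g z) :
    dzbar j (fun w => f w - g w) z = dzbar j f z - dzbar j g z := by
  have : fderiv ℝ (fun w => f w - g w) z = _ := fderiv_sub hf hg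
  simp only [dzbar, this, _root_.sub_apply]
  ring

/-- A real-differentiable solution of the Cauchy-Riemann equations is complex-differentiable. -/
theorem differentiableAt_complex_of_dzbar_eq_zero {n : ℕ} {f : Cn n → ℂ} {z : Cn n}
    (hf : DifferentiableAt ℝ f z) (h : ∀ j, dzbar j f z = 0) : DifferentiableAt ℂ f z := by
  set L := fderiv ℝ f z with hL
  have hI : ∀ j, L (Complex.I • basisVec j) = Complex.I * L (basisVec j) := by
    intro j
    have h2 : L (basisVec j) + Complex.I * L (Complex.I • basisVec j) = 0 := by
      have := h j
      rw [dzbar] at this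
      simpa using this
    linear_combination -Complex.I * h2 + L (Complex.I • basisVec j) * Complex.I_mul_I
  have hsmul : ∀ (c : ℂ) (j : Fin n), L (c • basisVec j) = c * L (basisVec j) := by
    intro c j
    have : c • basisVec j = c.re • basisVec j + c.im • (Complex.I • (basisVec j : Cn n)) := by
      conv_lhs => rw [← Complex.re_add_im c]
      rw [add_smul, mul_smul, Complex.coe_smul, Complex.coe_smul]
    rw [this, map_add, map_smul, map_smul, hI, Complex.real_smul, Complex.real_smul]
    conv_rhs => rw [← Complex.re_add_im c]
    ring
  have hsum : ∀ v : Cn n, L v = ∑ j, v j * L (basisVec j) := by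
    intro v
    have : v = ∑ j, v j • (basisVec j : Cn n) := by
      have := (EuclideanSpace.basisFun (Fin n) ℂ).sum_repr v
      simpa [basisVec] using this.symm
    calc L v = L (∑ j, v j • (basisVec j : Cn n)) := congrArg L this
      _ = _ := by rw [map_sum]; exact Finset.sum_congr rfl fun j _ => hsmul _ _
  rw [differentiableAt_iff_restrictScalars ℝ hf]
  refine ⟨LinearMap.toContinuousLinearMap
    { toFun := L
      map_add' := map_add L
      map_smul' := fun c v => by
        change L (c • v) = c * L v
        rw [hsum (c • v), hsum v, Finset.mul_sum]
        exact Finset.sum_congr rfl fun j _ => by rw [PiLp.smul_apply, smul_eq_mul, mul_assoc] }, ?_⟩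
  ext v; rfl

theorem differentiableOn_of_dzbar_eq_zero {n : ℕ} {U : Set (Cn n)} (hU : IsOpen U)
    {f : Cn n → ℂ} (hf : ContDiffOn ℝ ∞ f U) (h : ∀ z ∈ U, ∀ j, dzbar j f z = 0) :
    DifferentiableOn ℂ f U := fun z hz =>
  (differentiableAt_complex_of_dzbar_eq_zero
    ((hf.contDiffAt (hU.mem_nhds hz)).differentiableAt (by simp)) (h z hz)).differentiableWithinAt

/-! ### Mean value and Jensen inequalities for holomorphic functions -/

/-- Rotation about the origin by `e^{iθ}`. -/
noncomputable def rotation {n : ℕ} (θ : ℝ) : Cn n ≃ₗᵢ[ℝ] Cn n where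
  toFun v := Complex.exp (θ * Complex.I) • v
  invFun v := Complex.exp (-(θ * Complex.I)) • v
  map_add' := smul_add _
  map_smul' c v := smul_comm _ c v
  left_inv v := by
    dsimp only
    rw [smul_smul, ← Complex.exp_add]; simp
  right_inv v := by
    dsimp only
    rw [smul_smul, ← Complex.exp_add]; simp
  norm_map' v := by
    change ‖Complex.exp (θ * Complex.I) • v‖ = ‖v‖
    rw [norm_smul, Complex.norm_exp_ofReal_mul_I, one_mul]

/-- The sub-mean value inequality for `‖g‖²` on a circle. -/
theorem norm_sq_le_lintegral_circle {g : ℂ → ℂ}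
    (hg : DifferentiableOn ℂ g (Metric.closedBall 0 1)) :
    ENNReal.ofReal (2 * Real.pi) * ENNReal.ofReal (‖g 0‖ ^ 2) ≤
      ∫⁻ θ in Ioc 0 (2 * Real.pi),
        ENNReal.ofReal (‖g (Complex.exp (θ * Complex.I))‖ ^ 2) := by
  -- The mean value equality for the holomorphic function g² suffices, after taking norms inside the
  -- integral.
  have hG : DiffContOnCl ℂ (fun ζ => g ζ ^ 2) (Metric.ball 0 |1|) := by
    refine DifferentiableOn.diffContOnCl ?_
    rw [abs_one]
    exact (hg.pow 2).mono Metric.closure_ball_subset_closedBall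
  have h := hG.circleAverage
  rw [Real.circleAverage_def, intervalIntegral.integral_of_le (by positivity)] at h
  simp only [circleMap_zero, Complex.ofReal_one, one_mul] at h
  have hc : Continuous fun θ : ℝ => g (Complex.exp (θ * Complex.I)) :=
    hg.continuousOn.comp_continuous (by fun_prop) fun θ => by
      simp [Complex.norm_exp_ofReal_mul_I]
  have h2 : ‖g 0‖ ^ 2 * (2 * Real.pi) ≤
      ∫ θ in Ioc 0 (2 * Real.pi), ‖g (Complex.exp (θ * Complex.I))‖ ^ 2 := by
    have hn : ‖g 0‖ ^ 2 = ‖(2 * Real.pi)⁻¹ •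
        ∫ θ in Ioc 0 (2 * Real.pi), g (Complex.exp (θ * Complex.I)) ^ 2‖ := by
      rw [h, norm_pow]
    rw [hn, norm_smul, Real.norm_of_nonneg (by positivity), mul_comm, ← mul_assoc,
      mul_inv_cancel₀ (by positivity), one_mul]
    refine (norm_integral_le_integral_norm _).trans (le_of_eq ?_)
    simp only [norm_pow]
  rw [← ofReal_integral_eq_lintegral_ofReal, ← ENNReal.ofReal_mul (by positivity), mul_comm]
  · exact ENNReal.ofReal_le_ofReal h2
  · exact ((hc.norm.pow 2).integrableOn_Icc).mono_set Ioc_subset_Icc_self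
  · exact Filter.Eventually.of_forall fun θ => by positivity

/-- The sub-mean value inequality for `‖f‖²` on a ball. -/
theorem norm_sq_mul_volume_ball_le {n : ℕ} {f : Cn n → ℂ} {z : Cn n} {r : ℝ}
    (hf : DifferentiableOn ℂ f (Metric.ball z r)) :
    ENNReal.ofReal (‖f z‖ ^ 2) * volume (Metric.ball z r) ≤
      ∫⁻ w in Metric.ball z r, ENNReal.ofReal (‖f w‖ ^ 2) := by
  set F : Cn n → ℝ≥0∞ := (Metric.ball z r).indicator fun w => ENNReal.ofReal (‖f w‖ ^ 2) with hF
  have hFm : Measurable F := by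
    classical
    rw [hF, ← Set.piecewise_eq_indicator]
    exact (ENNReal.continuous_ofReal.comp_continuousOn
      (hf.continuousOn.norm.pow 2)).measurable_piecewise continuousOn_const measurableSet_ball
  -- Apply the circle inequality on each disc z + ζv, then integrate over v: rotations preserve
  -- volume, so after exchanging the integrals every θ contributes the same amount.
  have hpt : ∀ v : Cn n,
      ENNReal.ofReal (2 * Real.pi) * (ENNReal.ofReal (‖f z‖ ^ 2)
        * (Metric.ball (0 : Cn n) r).indicator 1 v) ≤
      ∫⁻ θ in Ioc 0 (2 * Real.pi), F (z + rotation θ v) := by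
    intro v
    by_cases hv : v ∈ Metric.ball (0 : Cn n) r
    · have hmem : ∀ ζ : ℂ, ‖ζ‖ ≤ 1 → z + ζ • v ∈ Metric.ball z r := by
        intro ζ hζ
        rw [mem_ball_iff_norm, add_sub_cancel_left, norm_smul]
        rw [mem_ball_zero_iff] at hv
        exact (mul_le_of_le_one_left (norm_nonneg v) hζ).trans_lt hv
      have hg : DifferentiableOn ℂ (fun ζ : ℂ => f (z + ζ • v)) (Metric.closedBall 0 1) :=
        hf.comp (by fun_prop) fun ζ hζ => hmem ζ (by simpa using hζ)
      have := norm_sq_le_lintegral_circle hg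
      rw [indicator_of_mem hv, Pi.one_apply, mul_one]
      simp only [zero_smul, add_zero] at this
      refine this.trans (le_of_eq (lintegral_congr fun θ => ?_))
      rw [hF, indicator_of_mem]
      · rfl
      · exact hmem _ (Complex.norm_exp_ofReal_mul_I θ).le
    · simp [indicator_of_notMem hv]
  have hrot : ∀ θ : ℝ, ∫⁻ v : Cn n, F (z + rotation θ v) = ∫⁻ w, F w := by
    intro θ
    rw [(rotation θ).measurePreserving.lintegral_comp (f := fun v => F (z + v)) (by fun_prop),
      lintegral_add_left_eq_self F z]
  have hmeas : Measurable fun p : Cn n × ℝ => F (z + rotation p.2 p.1) := by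
    refine hFm.comp (Continuous.measurable ?_)
    change Continuous fun p : Cn n × ℝ => z + Complex.exp (p.2 * Complex.I) • p.1
    fun_prop
  have hmain : ENNReal.ofReal (2 * Real.pi) * (ENNReal.ofReal (‖f z‖ ^ 2)
      * volume (Metric.ball (0 : Cn n) r)) ≤ ENNReal.ofReal (2 * Real.pi) * ∫⁻ w, F w := by
    calc _ = ∫⁻ v : Cn n, ENNReal.ofReal (2 * Real.pi) * (ENNReal.ofReal (‖f z‖ ^ 2)
        * (Metric.ball (0 : Cn n) r).indicator 1 v) := by
          rw [lintegral_const_mul' _ _ ENNReal.ofReal_ne_top,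
            lintegral_const_mul' _ _ ENNReal.ofReal_ne_top,
            lintegral_indicator_one measurableSet_ball]
      _ ≤ ∫⁻ v : Cn n, ∫⁻ θ in Ioc 0 (2 * Real.pi), F (z + rotation θ v) :=
          lintegral_mono hpt
      _ = ∫⁻ θ in Ioc 0 (2 * Real.pi), ∫⁻ v : Cn n, F (z + rotation θ v) :=
          lintegral_lintegral_swap hmeas.aemeasurable
      _ = _ := by
          simp only [hrot]
          rw [lintegral_const, Measure.restrict_apply_univ, Real.volume_Ioc, sub_zero, mul_comm]
  have hpi : ENNReal.ofReal (2 * Real.pi) ≠ 0 := by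
    simp [Real.pi_pos]
  rw [ENNReal.mul_le_mul_iff_right hpi ENNReal.ofReal_ne_top, hF,
    lintegral_indicator measurableSet_ball] at hmain
  rwa [Measure.addHaar_ball_center volume z r]

/-- Jensen's inequality: if `‖g 0‖ ≥ 1/2`, and `‖g‖² ≤ e^G` on the unit circle, then the mean of
`G` is at least `log (1/4)`. -/
theorem log_le_integral_of_norm_sq_le_exp {g : ℂ → ℂ}
    (hg : AnalyticOnNhd ℂ g (Metric.closedBall 0 1)) (h0 : 1 / 2 ≤ ‖g 0‖) {G : ℝ → ℝ}
    (hG : IntegrableOn G (Ioc 0 (2 * Real.pi)))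
    (hle : ∀ θ : ℝ, ‖g (Complex.exp (θ * Complex.I))‖ ^ 2 ≤ Real.exp (G θ)) :
    2 * Real.pi * Real.log (1 / 4) ≤ ∫ θ in Ioc 0 (2 * Real.pi), G θ := by
  have hg0 : g 0 ≠ 0 := by
    intro h; rw [h, norm_zero] at h0; norm_num at h0
  have hg' : AnalyticOnNhd ℂ g (Metric.closedBall 0 |1|) := by rwa [abs_one]
  have hmem : ∀ θ : ℝ, circleMap 0 1 θ = Complex.exp (θ * Complex.I) := fun θ => by
    simp [circleMap_zero]
  have hJ := hg'.circleAverage_log_norm one_ne_zero hg0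
  -- In Jensen's formula the zeros in the disc only raise the circle average above log‖g 0‖.
  have hsum : 0 ≤ ∑ᶠ u, (MeromorphicOn.divisor g (Metric.closedBall 0 |1|) u : ℝ)
      * Real.log (1 * ‖0 - u‖⁻¹) := by
    refine finsum_nonneg fun u => ?_
    by_cases hu : u ∈ Metric.closedBall (0 : ℂ) |1|
    · have hd : 0 ≤ MeromorphicOn.divisor g (Metric.closedBall 0 |1|) u :=
        MeromorphicOn.AnalyticOnNhd.divisor_nonneg hg' u
      refine mul_nonneg (by exact_mod_cast hd) ?_
      rw [zero_sub, norm_neg, one_mul, Real.log_inv]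
      have : ‖u‖ ≤ 1 := by simpa using hu
      have := Real.log_nonpos (norm_nonneg u) this
      linarith
    · rw [Function.locallyFinsuppWithin.apply_eq_zero_of_notMem _ hu]; simp
  have hlog : Real.log (1 / 4) ≤ 2 * Real.circleAverage (fun z => Real.log ‖g z‖) 0 1 := by
    have h1 : Real.log (1 / 2) ≤ Real.log ‖g 0‖ := Real.log_le_log (by norm_num) h0
    have h2 : Real.log (1 / 4) = 2 * Real.log (1 / 2) := by
      rw [← Real.log_rpow (by norm_num)]; norm_num
    rw [hJ, h2]; linarith
  have hint : IntegrableOn (fun θ : ℝ => Real.log ‖g (circleMap 0 1 θ)‖)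
      (Ioc 0 (2 * Real.pi)) := by
    have : CircleIntegrable (fun z => Real.log ‖g z‖) 0 1 :=
      MeromorphicOn.circleIntegrable_log_norm fun z hz =>
        (hg' z (Metric.sphere_subset_closedBall hz)).meromorphicAt
    exact (intervalIntegrable_iff_integrableOn_Ioc_of_le (by positivity)).1 this
  -- Zeros on the circle must be null: there `Real.log 0 = 0`, and the comparison with G could fail.
  have hae : ∀ᵐ θ ∂volume.restrict (Ioc 0 (2 * Real.pi)), g (circleMap 0 1 θ) ≠ 0 := by
    have hcod : ∀ᶠ z in Filter.codiscreteWithin (Metric.sphere (0 : ℂ) |1|), g z ≠ 0 := by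
      rcases hg'.eqOn_zero_or_eventually_ne_zero_of_preconnected
        (convex_closedBall _ _).isPreconnected with h | h
      · exact absurd (h (by simp)) hg0
      · exact Filter.codiscreteWithin_mono Metric.sphere_subset_closedBall h
    have := circleMap_preimage_codiscrete one_ne_zero hcod
    exact ae_restrict_le_codiscreteWithin measurableSet_Ioc
      (Filter.codiscreteWithin_mono (subset_univ _) this)
  rw [Real.circleAverage_def, intervalIntegral.integral_of_le (by positivity)] at hlog
  have hmono : ∫ θ in Ioc 0 (2 * Real.pi), 2 * Real.log ‖g (circleMap 0 1 θ)‖ ≤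
      ∫ θ in Ioc 0 (2 * Real.pi), G θ := by
    refine integral_mono_ae (hint.const_mul 2) hG ?_
    filter_upwards [hae] with θ hθ
    have := Real.log_le_log (by rw [← hmem]; exact pow_pos (norm_pos_iff.2 hθ) 2) (hle θ)
    rwa [Real.log_exp, Real.log_pow, ← hmem] at this
  rw [integral_const_mul] at hmono
  refine le_trans ?_ hmono
  have := mul_le_mul_of_nonneg_left hlog (by positivity : 0 ≤ 2 * Real.pi)
  refine this.trans (le_of_eq ?_)
  rw [smul_eq_mul]
  field_simp

/-! ### Circle means of extended-real functions -/

/-- This is x⁻ - x⁺ = -x, arranged with sums so that no ∞ - ∞ occurs. -/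
theorem toENNReal_neg_add_ofReal {x : EReal} {M : ℝ} (hM : 0 ≤ M) (hx : x ≤ M) :
    (-x).toENNReal + ENNReal.ofReal M = ((M : EReal) - x).toENNReal + x.toENNReal := by
  induction x with
  | bot => simp
  | top => simp at hx
  | coe x =>
    have hx' : x ≤ M := by exact_mod_cast hx
    rw [← EReal.coe_neg, ← EReal.coe_sub]
    simp only [EReal.real_coe_toENNReal]
    rcases le_total 0 x with h | h
    · rw [ENNReal.ofReal_of_nonpos (by linarith : -x ≤ 0), zero_add,
        ← ENNReal.ofReal_add (by linarith) h]
      congr 1; ring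
    · rw [ENNReal.ofReal_of_nonpos h, add_zero, ← ENNReal.ofReal_add (by linarith) hM]
      congr 1; ring

/-- The hypothesis concerns the nonnegative function M - f, the form in which monotone convergence
delivers it. It also forces the negative part to be integrable. -/
theorem coe_le_circleMean {f : ℝ → EReal} (hf : Measurable f) {c M : ℝ} (hM : 0 ≤ M)
    (hcM : c ≤ M) (hfM : ∀ θ, f θ ≤ M)
    (h : ∫⁻ θ in Ioc 0 (2 * Real.pi), ((M : EReal) - f θ).toENNReal ≤
      ENNReal.ofReal (2 * Real.pi * (M - c))) :
    (c : EReal) ≤ circleMean f := by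
  have hpi := Real.pi_pos
  have hvol : volume (Ioc 0 (2 * Real.pi)) = ENNReal.ofReal (2 * Real.pi) := by
    rw [Real.volume_Ioc, sub_zero]
  set P := ∫⁻ θ in Ioc 0 (2 * Real.pi), (f θ).toENNReal with hP
  set N := ∫⁻ θ in Ioc 0 (2 * Real.pi), (-f θ).toENNReal with hN
  have hadd : N + ENNReal.ofReal (M * (2 * Real.pi)) ≤
      ENNReal.ofReal (2 * Real.pi * (M - c)) + P := by
    have h1 : N + ENNReal.ofReal (M * (2 * Real.pi)) =
        (∫⁻ θ in Ioc 0 (2 * Real.pi), ((M : EReal) - f θ).toENNReal) + P := by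
      rw [hP, ← lintegral_add_right _ hf.ereal_toENNReal, ENNReal.ofReal_mul hM, ← hvol,
        ← setLIntegral_const, hN, ← lintegral_add_right _ measurable_const]
      exact lintegral_congr fun θ => toENNReal_neg_add_ofReal hM (hfM θ)
    rw [h1]; gcongr
  have hPtop : P ≠ ⊤ := by
    refine ne_top_of_le_ne_top (b := ∫⁻ _ in Ioc 0 (2 * Real.pi), ENNReal.ofReal M) ?_
      (lintegral_mono fun θ => ?_)
    · rw [setLIntegral_const, hvol]; exact ENNReal.mul_ne_top ENNReal.ofReal_ne_top ENNReal.ofReal_ne_top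
    · simpa using EReal.toENNReal_le_toENNReal (hfM θ)
  have hNtop : N ≠ ⊤ := by
    intro hN'
    rw [hN', top_add, top_le_iff, ENNReal.add_eq_top] at hadd
    rcases hadd with h | h
    · exact ENNReal.ofReal_ne_top h
    · exact hPtop h
  have hreal : N.toReal + M * (2 * Real.pi) ≤ 2 * Real.pi * (M - c) + P.toReal := by
    have h2 : 0 ≤ 2 * Real.pi * (M - c) := mul_nonneg (by positivity) (by linarith)
    have := ENNReal.toReal_mono
      (ENNReal.add_ne_top.2 ⟨ENNReal.ofReal_ne_top, hPtop⟩) hadd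
    rwa [ENNReal.toReal_add hNtop (by simp), ENNReal.toReal_add (by simp) hPtop,
      ENNReal.toReal_ofReal (by positivity), ENNReal.toReal_ofReal h2] at this
  have hinv : ∀ {X : ℝ≥0∞}, X ≠ ⊤ →
      (((ENNReal.ofReal (2 * Real.pi))⁻¹ * X : ℝ≥0∞) : EReal)
        = (((2 * Real.pi)⁻¹ * X.toReal : ℝ) : EReal) := by
    intro X hX
    rw [← ENNReal.ofReal_inv_of_pos (by positivity)]
    conv_lhs => rw [← ENNReal.ofReal_toReal hX]
    rw [← ENNReal.ofReal_mul (by positivity), EReal.coe_ennreal_ofReal,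
      max_eq_left (by positivity)]
  rw [circleMean, ← hP, ← hN, hinv hPtop, hinv hNtop, ← EReal.coe_sub, EReal.coe_le_coe_iff,
    ← mul_sub, inv_mul_eq_div, le_div_iff₀ (by positivity)]
  linarith

theorem coe_le_circleMean_const (c : ℝ) : (c : EReal) ≤ circleMean fun _ => (c : EReal) := by
  refine coe_le_circleMean measurable_const (abs_nonneg c) (le_abs_self c)
    (fun _ => by exact_mod_cast le_abs_self c) ?_
  rw [setLIntegral_const, Real.volume_Ioc, sub_zero, ← EReal.coe_sub, EReal.real_coe_toENNReal,
    ← ENNReal.ofReal_mul (sub_nonneg.2 (le_abs_self c)), mul_comm]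

/-! ### Weighted estimates -/

theorem weight_le {n m : ℕ} {φ : Cn n → EReal} {ψ : Cn n → ℝ} {z : Cn n} {c p : ℝ}
    (hc : (c : EReal) ≤ φ z) (hp : p ≤ ψ z) :
    weight m φ ψ z ≤ ENNReal.ofReal (Real.exp (-(m * c + p))) := by
  rw [weight, ← EReal.exp_coe]
  refine EReal.exp_monotone ?_
  push_cast
  rw [EReal.neg_le_neg_iff]
  refine add_le_add (mul_le_mul_of_nonneg_left hc (by positivity)) (by exact_mod_cast hp)

theorem le_weight {n m : ℕ} {φ : Cn n → EReal} {ψ : Cn n → ℝ} {z : Cn n} {T q : ℝ}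
    (hT : φ z ≤ T) (hq : ψ z ≤ q) :
    ENNReal.ofReal (Real.exp (-(m * T + q))) ≤ weight m φ ψ z := by
  rw [weight, ← EReal.exp_coe]
  refine EReal.exp_monotone ?_
  push_cast
  rw [EReal.neg_le_neg_iff]
  refine add_le_add (mul_le_mul_of_nonneg_left hT (by positivity)) (by exact_mod_cast hq)

theorem formNormSq_eq_zero {n : ℕ} {ψ : Cn n → ℝ} {α : Fin n → Cn n → ℂ} {z : Cn n}
    (h : ∀ j, α j z = 0) : formNormSq ψ α z = 0 := by
  simp [formNormSq, h]

/-- If `φ ≤ T` and `ψ ≤ q` on a ball in `Ω`, then a holomorphic function `f` with finite weighted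
norm on a set containing the ball is controlled at the centre. -/
theorem norm_sq_mul_volume_le_of_lintegral {n m : ℕ} {φ : Cn n → EReal} {ψ : Cn n → ℝ}
    {f : Cn n → ℂ} {U : Set (Cn n)} {z : Cn n} {r T q : ℝ} (hU : Metric.ball z r ⊆ U)
    (hf : DifferentiableOn ℂ f (Metric.ball z r)) (hT : ∀ w ∈ Metric.ball z r, φ w ≤ T)
    (hq : ∀ w ∈ Metric.ball z r, ψ w ≤ q) :
    ENNReal.ofReal (‖f z‖ ^ 2) * volume (Metric.ball z r) ≤
      ENNReal.ofReal (Real.exp (m * T + q)) *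
        ∫⁻ w in U, ENNReal.ofReal (‖f w‖ ^ 2) * weight m φ ψ w := by
  refine (norm_sq_mul_volume_ball_le hf).trans ?_
  rw [← lintegral_const_mul' _ _ ENNReal.ofReal_ne_top]
  refine le_trans ?_ (lintegral_mono_set hU)
  refine setLIntegral_mono' measurableSet_ball fun w hw => ?_
  calc ENNReal.ofReal (‖f w‖ ^ 2)
      = ENNReal.ofReal (Real.exp (m * T + q)) * (ENNReal.ofReal (‖f w‖ ^ 2)
        * ENNReal.ofReal (Real.exp (-(m * T + q)))) := by
        rw [mul_left_comm, ← ENNReal.ofReal_mul (Real.exp_nonneg _), ← Real.exp_add]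
        simp
    _ ≤ _ := by gcongr; exact le_weight (hT w hw) (hq w hw)

theorem logWeight_le {n : ℕ} {a z : Cn n} {δ ρ : ℝ} (hδ0 : 0 < δ)
    (hz : ‖z - a‖ ≤ ρ) :
    logWeight a δ z ≤ ρ ^ 2 + (n + 1) * Real.log (ρ ^ 2 + δ ^ 2) := by
  unfold logWeight
  have h : ‖z - a‖ ^ 2 ≤ ρ ^ 2 := by gcongr
  have : Real.log (‖z - a‖ ^ 2 + δ ^ 2) ≤ Real.log (ρ ^ 2 + δ ^ 2) :=
    Real.log_le_log (by positivity) (by linarith)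
  gcongr

theorem le_logWeight {n : ℕ} {a z : Cn n} {δ ρ : ℝ} (hρ : 0 < ρ) (hz : ρ ≤ ‖z - a‖) :
    (n + 1) * Real.log (ρ ^ 2) ≤ logWeight a δ z := by
  unfold logWeight
  have h : ρ ^ 2 ≤ ‖z - a‖ ^ 2 := by gcongr
  have : Real.log (ρ ^ 2) ≤ Real.log (‖z - a‖ ^ 2 + δ ^ 2) :=
    Real.log_le_log (by positivity) (by nlinarith)
  have h2 : ((n : ℝ) + 1) * Real.log (ρ ^ 2) ≤
    (n + 1) * Real.log (‖z - a‖ ^ 2 + δ ^ 2) := by gcongr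
  have := sq_nonneg ‖z - a‖
  linarith

theorem exists_small_radius {V K R : ℝ} (hV : 0 < V) (hR : 0 < R) :
    ∃ δ, 0 < δ ∧ δ ≤ 1 ∧ δ < R ∧ K * δ ^ 2 ≤ V := by
  have h1 : ∀ᶠ δ in nhdsWithin (0 : ℝ) (Ioi 0), K * δ ^ 2 < V := by
    have : Filter.Tendsto (fun δ : ℝ => K * δ ^ 2) (nhds 0) (nhds 0) :=
      Continuous.tendsto' (by fun_prop) _ _ (by simp)
    exact (this.mono_left nhdsWithin_le_nhds).eventually_lt_const hV
  have h2 : ∀ᶠ δ in nhdsWithin (0 : ℝ) (Ioi 0), δ < min 1 R :=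
    nhdsWithin_le_nhds (gt_mem_nhds (lt_min one_pos hR))
  obtain ⟨δ, ⟨hK, hm⟩, h0⟩ := ((h1.and h2).and self_mem_nhdsWithin).exists
  exact ⟨δ, h0, (hm.trans_le (min_le_left _ _)).le, hm.trans_le (min_le_right _ _), hK.le⟩

theorem finrank_real_Cn (n : ℕ) : Module.finrank ℝ (Cn n) = 2 * n := by
  rw [← Module.finrank_mul_finrank ℝ ℂ (Cn n), Complex.finrank_real_complex,
    finrank_euclideanSpace_fin]

/-- The unit ball of `ℂⁿ` has finite positive volume. -/
theorem exists_volume_unitBall (n : ℕ) :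
    ∃ V : ℝ, 0 < V ∧ ∀ (a : Cn n) (r : ℝ), 0 < r →
      volume (Metric.ball a r) = ENNReal.ofReal (r ^ (2 * n) * V) := by
  refine ⟨(volume (Metric.ball (0 : Cn n) 1)).toReal,
    ENNReal.toReal_pos (Metric.measure_ball_pos volume _ one_pos).ne' measure_ball_lt_top.ne,
    fun a r hr => ?_⟩
  rw [Measure.addHaar_ball_of_pos volume a hr, finrank_real_Cn,
    ENNReal.ofReal_mul (by positivity), ENNReal.ofReal_toReal measure_ball_lt_top.ne]

/-- A function with a small weighted norm for the almost singular weight `logWeight a δ` is small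
at `a`. -/
theorem norm_le_half_of_lintegral_logWeight {n m : ℕ} {φ : Cn n → EReal} {u : Cn n → ℂ}
    {U : Set (Cn n)} {a : Cn n} {δ T D V : ℝ} (hV : 0 < V)
    (hvol : volume (Metric.ball a δ) = ENNReal.ofReal (δ ^ (2 * n) * V))
    (hδ0 : 0 < δ) (hδ1 : δ ≤ 1)
    (hU : Metric.ball a δ ⊆ U) (hu : DifferentiableOn ℂ u (Metric.ball a δ))
    (hT : ∀ w ∈ Metric.ball a δ, φ w ≤ T) (hD : 0 ≤ D)
    (hint : ∫⁻ z in U, ENNReal.ofReal (‖u z‖ ^ 2) * weight m φ (logWeight a δ) z ≤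
      ENNReal.ofReal D)
    (hδ : Real.exp (m * T + 1) * 2 ^ (n + 1) * D * δ ^ 2 ≤ V / 4) : ‖u a‖ ≤ 1 / 2 := by
  have h1 := norm_sq_mul_volume_le_of_lintegral (m := m) (φ := φ) (ψ := logWeight a δ) (T := T)
    hU hu hT fun w hw => logWeight_le hδ0 (by rw [← dist_eq_norm]; exact (Metric.mem_ball.1 hw).le)
  have h2 := h1.trans (mul_le_mul_right hint _)
  rw [hvol, ← ENNReal.ofReal_mul (sq_nonneg _), ← ENNReal.ofReal_mul (Real.exp_nonneg _),
    ENNReal.ofReal_le_ofReal_iff (mul_nonneg (Real.exp_nonneg _) hD)] at h2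
  -- The factor δ^{2n} cancels the volume of the ball; the spare δ² comes from the coefficient n + 1
  -- instead of n.
  have h3 : Real.exp (m * T + (δ ^ 2 + (n + 1) * Real.log (δ ^ 2 + δ ^ 2)))
      ≤ Real.exp (m * T + 1) * (2 ^ (n + 1) * δ ^ 2 * δ ^ (2 * n)) := by
    have : Real.exp ((n + 1) * Real.log (δ ^ 2 + δ ^ 2)) = 2 ^ (n + 1) * δ ^ 2 * δ ^ (2 * n) := by
      rw [mul_comm, Real.exp_mul, Real.exp_log (by positivity)]
      rw [show (n : ℝ) + 1 = ((n + 1 : ℕ) : ℝ) by push_cast; ring, Real.rpow_natCast, ← two_mul,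
        mul_pow, ← pow_mul]
      ring
    rw [← add_assoc, Real.exp_add, this]
    gcongr
    nlinarith
  have h4 : ‖u a‖ ^ 2 * (δ ^ (2 * n) * V) ≤
      (Real.exp (m * T + 1) * 2 ^ (n + 1) * D * δ ^ 2) * δ ^ (2 * n) := by
    refine h2.trans ((mul_le_mul_of_nonneg_right h3 hD).trans (le_of_eq ?_))
    ring
  have h5 : ‖u a‖ ^ 2 * (δ ^ (2 * n) * V) ≤ (1 / 2) ^ 2 * (δ ^ (2 * n) * V) := by
    refine h4.trans ((mul_le_mul_of_nonneg_right hδ (by positivity)).trans (le_of_eq ?_))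
    ring
  exact (pow_le_pow_iff_left₀ (norm_nonneg _) (by norm_num) two_ne_zero).1
    (le_of_mul_le_mul_right h5 (by positivity))

/-! ### Construction of the peak function -/

/-- A smooth cutoff function supported in a ball and with `∂̄X = 0` near the centre. -/
theorem exists_cutoff {n : ℕ} (a : Cn n) {R : ℝ} (hR : 0 < R) :
    ∃ X : Cn n → ℂ, ContDiff ℝ ∞ X ∧ tsupport X = Metric.closedBall a R ∧ X a = 1 ∧
      ∀ z ∈ Metric.ball a (R / 2), ∀ j, dzbar j X z = 0 := by
  let χ : ContDiffBump a := ⟨R / 2, R, by positivity, by linarith⟩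
  refine ⟨fun z => (χ z : ℂ), Complex.ofRealCLM.contDiff.comp χ.contDiff, ?_, ?_,
    fun z hz j => ?_⟩
  · have : (Function.support fun z => (χ z : ℂ)) = Function.support χ := by ext z; simp
    rw [tsupport, this]; exact χ.tsupport_eq
  · simp [χ.one_of_mem_closedBall (Metric.mem_closedBall_self χ.rIn_pos.le)]
  · have : (fun z => (χ z : ℂ)) =ᶠ[nhds z] fun _ => 1 := by
      filter_upwards [χ.eventuallyEq_one_of_mem_ball hz] with w hw
      simp [hw]
    simp [dzbar, this.fderiv_eq]

/-- The twisted Hörmander condition gives a holomorphic function which is not small at `a`, with a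
weighted estimate off `a` whose constant `C` does not depend on the power `m`. -/
theorem exists_holomorphic_peak {n : ℕ} {Ω : Set (Cn n)} (hΩ : IsOpen Ω) {φ : Cn n → EReal}
    (hH : TwistedHormanderCondition Ω φ) {a : Cn n} {R c T : ℝ} (hR : 0 < R)
    (hball : Metric.closedBall a R ⊆ Ω)
    (hc : ∀ z ∈ Metric.closedBall a R, (c : EReal) ≤ φ z)
    (hT : ∀ z ∈ Metric.closedBall a R, φ z ≤ T) :
    ∃ C : ℝ, 0 ≤ C ∧ ∀ m : ℕ, 0 < m → ∃ (δ : ℝ) (f : Cn n → ℂ), 0 < δ ∧ δ ≤ 1 ∧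
      DifferentiableOn ℂ f Ω ∧ 1 / 2 ≤ ‖f a‖ ∧
      ∫⁻ z in Ω \ Metric.closedBall a R,
          ENNReal.ofReal (‖f z‖ ^ 2) * weight m φ (logWeight a δ) z ≤
        ENNReal.ofReal (C * Real.exp (-(m * c))) := by
  obtain ⟨X, hXs, hXsupp, hXa, hX_in⟩ := exists_cutoff a hR
  have hXc : HasCompactSupport X := by
    rw [HasCompactSupport, hXsupp]; exact isCompact_closedBall a R
  set α : Fin n → Cn n → ℂ := fun j => dzbar j X with hα
  have htest : IsTestForm Ω α := isTestForm_dzbar hXs hXc (hXsupp ▸ hball)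
  have hα_out : ∀ z ∉ Metric.closedBall a R, ∀ j, α j z = 0 := fun z hz j =>
    image_eq_zero_of_notMem_tsupport fun h => hz (hXsupp ▸ tsupport_dzbar_subset j X h)
  have hα_in : ∀ z ∈ Metric.ball a (R / 2), ∀ j, α j z = 0 := hX_in
  obtain ⟨A, hA⟩ := (isCompact_closedBall a R).exists_bound_of_continuousOn
    (f := fun z => ∑ j, ‖α j z‖ ^ 2)
    (continuous_finsetSum _ fun j _ => ((htest.smooth j).continuous.norm.pow 2)).continuousOn
  have hA' : ∀ z ∈ Metric.closedBall a R, ∑ j, ‖α j z‖ ^ 2 ≤ A := fun z hz =>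
    (le_abs_self _).trans (hA z hz)
  have hA0 : 0 ≤ A := (norm_nonneg _).trans (hA a (by simp [hR.le]))
  set V := (volume (Metric.closedBall a R)).toReal with hV
  -- On the support of α one has ‖z - a‖ ≥ R/2, so `logWeight` is bounded below there independently
  -- of δ.
  set C := A * Real.exp (-((n + 1) * Real.log ((R / 2) ^ 2))) * V with hC
  have hC0 : 0 ≤ C := by positivity
  refine ⟨C, hC0, fun m hm => ?_⟩
  set D := C * Real.exp (-(m * c)) with hD
  have hD0 : 0 ≤ D := by positivity
  have hform : ∀ δ : ℝ, 0 < δ →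
      ∫⁻ z in Ω, ENNReal.ofReal (formNormSq (logWeight a δ) α z) *
        weight m φ (logWeight a δ) z ≤ ENNReal.ofReal D := by
    intro δ hδ
    have hpt : ∀ z, ENNReal.ofReal (formNormSq (logWeight a δ) α z) *
        weight m φ (logWeight a δ) z ≤ (Metric.closedBall a R).indicator
          (fun _ => ENNReal.ofReal (A * Real.exp (-((n + 1) * Real.log ((R / 2) ^ 2)))
            * Real.exp (-(m * c)))) z := by
      intro z
      by_cases hz : z ∈ Metric.closedBall a R
      · rw [indicator_of_mem hz]
        by_cases hz' : z ∈ Metric.ball a (R / 2)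
        · simp [formNormSq_eq_zero (hα_in z hz')]
        · rw [mul_assoc, ENNReal.ofReal_mul hA0, ← Real.exp_add]
          refine mul_le_mul' (ENNReal.ofReal_le_ofReal
            ((formNormSq_logWeight_le a hδ α z).trans (hA' z hz))) ?_
          refine (weight_le (hc z hz) (le_logWeight (half_pos hR) ?_)).trans (le_of_eq ?_)
          · rw [Metric.mem_ball, not_lt, dist_eq_norm] at hz'; exact hz'
          · congr 2; ring
      · simp [formNormSq_eq_zero (hα_out z hz)]
    refine (setLIntegral_le_lintegral _ _).trans ((lintegral_mono hpt).trans (le_of_eq ?_))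
    rw [lintegral_indicator_const Metric.isClosed_closedBall.measurableSet,
      ← ENNReal.ofReal_toReal (measure_closedBall_lt_top (x := a) (r := R)).ne, ← hV,
      ← ENNReal.ofReal_mul (by positivity)]
    congr 1
    rw [hD, hC]; ring
  obtain ⟨V₁, hV₁0, hvol⟩ := exists_volume_unitBall n
  -- δ depends on m through the factor e^{mT}; this is harmless since D does not depend on δ.
  obtain ⟨δ, hδ0, hδ1, hδR, hδK⟩ := exists_small_radius
    (K := Real.exp (m * T + 1) * 2 ^ (n + 1) * D) (V := V₁ / 4) (by positivity) (half_pos hR)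
  obtain ⟨u, hu, hdu, hint⟩ := hH m hm (logWeight a δ) (smoothStrictlyPSH_logWeight Ω a hδ0) α
    htest ((hform δ hδ0).trans_lt ENNReal.ofReal_lt_top)
  have hint' := hint.trans (hform δ hδ0)
  have hballδ : Metric.ball a δ ⊆ Metric.closedBall a R :=
    (Metric.ball_subset_ball (by linarith)).trans Metric.ball_subset_closedBall
  have hu_diff : DifferentiableOn ℂ u (Metric.ball a δ) :=
    differentiableOn_of_dzbar_eq_zero Metric.isOpen_ball (hu.mono (hballδ.trans hball))
      fun z hz j => (hdu z (hball (hballδ hz)) j).trans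
        (hα_in z (Metric.ball_subset_ball hδR.le hz) j)
  have hua : ‖u a‖ ≤ 1 / 2 :=
    norm_le_half_of_lintegral_logWeight hV₁0 (hvol a δ hδ0) hδ0 hδ1 (hballδ.trans hball) hu_diff
      (fun w hw => hT w (hballδ hw)) hD0 hint' hδK
  refine ⟨δ, fun z => X z - u z, hδ0, hδ1, ?_, ?_, ?_⟩
  · refine differentiableOn_of_dzbar_eq_zero hΩ (hXs.contDiffOn.sub hu) fun z hz j => ?_
    rw [dzbar_sub j (hXs.differentiable (by simp) z)
      ((hu.contDiffAt (hΩ.mem_nhds hz)).differentiableAt (by simp)), hdu z hz j]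
    exact sub_self _
  · have := norm_sub_norm_le (X a) (u a)
    rw [hXa, norm_one] at this
    change 1 / 2 ≤ ‖X a - u a‖
    rw [hXa]; linarith
  · refine le_trans (le_of_eq ?_)
      ((lintegral_mono_set (sdiff_subset (t := Metric.closedBall a R))).trans hint')
    refine setLIntegral_congr_fun (hΩ.measurableSet.diff
      Metric.isClosed_closedBall.measurableSet) fun z hz => ?_
    have : X z = 0 := image_eq_zero_of_notMem_tsupport fun h => hz.2 (hXsupp ▸ h)
    simp only [this, zero_sub, norm_neg]

/-! ### The mean value inequality for majorants of φ -/

theorem isOpen_diff_pole {n : ℕ} {Ω : Set (Cn n)} (hΩ : IsOpen Ω) {φ : Cn n → EReal}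
    (hpole : IsClosed {z : Ω | φ z = ⊥}) : IsOpen (Ω \ pole Ω φ) := by
  have : Ω \ pole Ω φ = Subtype.val '' {z : Ω | φ z = ⊥}ᶜ := by
    ext z
    simp only [pole, Set.mem_sdiff, mem_image, mem_compl_iff, Subtype.exists, mem_ofPred_eq]
    constructor
    · rintro ⟨h1, h2⟩
      exact ⟨z, h1, fun h => h2 ⟨h1, h⟩, rfl⟩
    · rintro ⟨w, hw, h, rfl⟩
      exact ⟨hw, fun h' => h h'.2⟩
  rw [this]
  exact hΩ.isOpenMap_subtype_val _ hpole.isOpen_compl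

/-- The Hölder condition enters only here, as continuity off the poles. The lower bound on φ
controls the weight on the support of ∂̄X; the upper bound serves to make u(a) small. -/
theorem exists_closedBall_near {n : ℕ} {Ω : Set (Cn n)} (hΩ : IsOpen Ω) {φ : Cn n → EReal}
    (hlt : ∀ z ∈ Ω, φ z < ⊤) (hpole : IsClosed {z : Ω | φ z = ⊥})
    (hholder : LocallyHolderOffPoles Ω φ) {a : Cn n} (ha : a ∈ Ω) {c : ℝ} (hc : φ a = c)
    {η R₁ : ℝ} (hη : 0 < η) (hR₁ : 0 < R₁) :
    ∃ R, 0 < R ∧ R ≤ R₁ ∧ Metric.closedBall a R ⊆ Ω ∧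
      ∀ z ∈ Metric.closedBall a R, ((c - η : ℝ) : EReal) ≤ φ z ∧ φ z ≤ (c + η : ℝ) := by
  have haU : a ∈ Ω \ pole Ω φ := ⟨ha, fun h => absurd h.2 (by simp [hc])⟩
  obtain ⟨ρ, hρ, hsub⟩ := Metric.nhds_basis_closedBall.mem_iff.1
    ((isOpen_diff_pole hΩ hpole).mem_nhds haU)
  have hcl : closure (Metric.ball a ρ) ⊆ Metric.closedBall a ρ :=
    Metric.closure_ball_subset_closedBall
  obtain ⟨α, C, hα, -, hC, hest⟩ := hholder (Metric.ball a ρ) Metric.isOpen_ball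
    ((isCompact_closedBall a ρ).of_isClosed_subset isClosed_closure hcl) (hcl.trans hsub)
  have h1 : ∀ᶠ R in nhdsWithin (0 : ℝ) (Ioi 0), C * R ^ α < η := by
    have : Filter.Tendsto (fun R : ℝ => C * R ^ α) (nhds 0) (nhds (C * 0 ^ α)) :=
      ((Real.continuousAt_rpow_const 0 α (Or.inr hα.le)).tendsto).const_mul C
    rw [Real.zero_rpow hα.ne', mul_zero] at this
    exact (this.mono_left nhdsWithin_le_nhds).eventually_lt_const hη
  have h2 : ∀ᶠ R in nhdsWithin (0 : ℝ) (Ioi 0), R < min ρ R₁ :=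
    nhdsWithin_le_nhds (gt_mem_nhds (lt_min hρ hR₁))
  obtain ⟨R, ⟨hRη, hRm⟩, hR0⟩ := ((h1.and h2).and self_mem_nhdsWithin).exists
  have hR0 : 0 < R := hR0
  have hRρ : R < ρ := hRm.trans_le (min_le_left _ _)
  have hball : Metric.closedBall a R ⊆ Ω \ pole Ω φ :=
    (Metric.closedBall_subset_closedBall hRρ.le).trans hsub
  refine ⟨R, hR0, (hRm.trans_le (min_le_right _ _)).le, hball.trans sdiff_subset, fun z hz => ?_⟩
  have hzΩ := hball hz
  have hzne : φ z ≠ ⊥ := fun h => hzΩ.2 ⟨hzΩ.1, h⟩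
  have hest' := hest z (Metric.closedBall_subset_ball hRρ hz) a (Metric.mem_ball_self hρ)
  have hle : C * ‖z - a‖ ^ α ≤ C * R ^ α := by
    have : ‖z - a‖ ≤ R := by rw [← dist_eq_norm]; exact hz
    gcongr
  rw [hc, EReal.toReal_coe, abs_le] at hest'
  rw [← EReal.coe_toReal (hlt z hzΩ.1).ne hzne, EReal.coe_le_coe_iff, EReal.coe_le_coe_iff]
  constructor <;> linarith [hest'.1, hest'.2]

/-- A real majorant `h` of `φ` on small balls about the points of a circle has mean at least the
value at the centre. -/
theorem mul_le_integral_of_le_on_balls {n : ℕ} {Ω : Set (Cn n)} (hΩ : IsOpen Ω)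
    {φ : Cn n → EReal} (hH : TwistedHormanderCondition Ω φ) {a b : Cn n} (hb : b ≠ 0)
    (hdisc : ∀ ζ : ℂ, ‖ζ‖ ≤ 1 → a + ζ • b ∈ Ω) {c : ℝ}
    (hnear : ∀ η R₁ : ℝ, 0 < η → 0 < R₁ → ∃ R, 0 < R ∧ R ≤ R₁ ∧ Metric.closedBall a R ⊆ Ω ∧
      ∀ z ∈ Metric.closedBall a R, ((c - η : ℝ) : EReal) ≤ φ z ∧ φ z ≤ (c + η : ℝ))
    {r : ℝ} (hr : 0 < r) (hrb : r ≤ ‖b‖ / 2)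
    (hrΩ : ∀ θ : ℝ, Metric.ball (a + Complex.exp (θ * Complex.I) • b) r ⊆ Ω) {h : ℝ → ℝ}
    (hint : IntegrableOn h (Ioc 0 (2 * Real.pi)))
    (hle : ∀ θ : ℝ, ∀ y ∈ Metric.ball (a + Complex.exp (θ * Complex.I) • b) r, φ y ≤ h θ) :
    2 * Real.pi * c ≤ ∫ θ in Ioc 0 (2 * Real.pi), h θ := by
  have hpi := Real.pi_pos
  have hb0 : 0 < ‖b‖ := norm_pos_iff.2 hb
  suffices H : ∀ η : ℝ, 0 < η → 2 * Real.pi * (c - η) ≤ ∫ θ in Ioc 0 (2 * Real.pi), h θ by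
    refine le_of_forall_pos_le_add fun ε hε => ?_
    have := H (ε / (2 * Real.pi)) (by positivity)
    rw [mul_sub, mul_div_cancel₀ _ (by positivity)] at this
    linarith
  intro η hη
  -- With r ≤ ‖b‖/2, the choice R ≤ ‖b‖/4 keeps the r-balls about the circle away from the R-ball
  -- about a.
  obtain ⟨R, hR, hRb, hRΩ, hφR⟩ := hnear η (‖b‖ / 4) hη (by positivity)
  obtain ⟨C, hC, hpeak⟩ := exists_holomorphic_peak hΩ hH hR hRΩ (fun z hz => (hφR z hz).1)
    (fun z hz => (hφR z hz).2)
  obtain ⟨V, hV, hvol⟩ := exists_volume_unitBall n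
  set q : ℝ := (‖b‖ + r) ^ 2 + (n + 1) * Real.log ((‖b‖ + r) ^ 2 + 1) with hq
  -- C + 1 keeps the logarithm's argument positive. As q uses only δ ≤ 1, E is independent of m.
  set E : ℝ := q + Real.log ((C + 1) / (r ^ (2 * n) * V)) with hE
  have hnorm : ∀ θ : ℝ, ‖Complex.exp (θ * Complex.I) • b‖ = ‖b‖ := fun θ => by
    rw [norm_smul, Complex.norm_exp_ofReal_mul_I, one_mul]
  have hdist : ∀ θ : ℝ, ∀ y ∈ Metric.ball (a + Complex.exp (θ * Complex.I) • b) r,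
      ‖b‖ - r < ‖y - a‖ ∧ ‖y - a‖ ≤ ‖b‖ + r := by
    intro θ y hy
    rw [mem_ball_iff_norm, ← sub_sub] at hy
    have h1 := norm_sub_norm_le (Complex.exp (θ * Complex.I) • b) (y - a)
    have h2 := norm_sub_norm_le (y - a) (Complex.exp (θ * Complex.I) • b)
    rw [norm_sub_rev (Complex.exp (θ * Complex.I) • b), hnorm] at h1
    rw [hnorm] at h2
    constructor <;> linarith
  have hstep : ∀ m : ℕ, 0 < m → 2 * Real.pi * Real.log (1 / 4) ≤
      2 * Real.pi * E + m * ((∫ θ in Ioc 0 (2 * Real.pi), h θ) - 2 * Real.pi * (c - η)) := by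
    intro m hm
    obtain ⟨δ, f, hδ0, hδ1, hf, hfa, hfint⟩ := hpeak m hm
    have hopen : IsOpen {ζ : ℂ | a + ζ • b ∈ Ω} := hΩ.preimage (by fun_prop)
    have hg : AnalyticOnNhd ℂ (fun ζ : ℂ => f (a + ζ • b)) (Metric.closedBall 0 1) := by
      have : DifferentiableOn ℂ (fun ζ : ℂ => f (a + ζ • b)) {ζ : ℂ | a + ζ • b ∈ Ω} :=
        hf.comp (by fun_prop) fun ζ hζ => hζ
      exact (this.analyticOnNhd hopen).mono fun ζ hζ => hdisc ζ (by simpa using hζ)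
    have hbound : ∀ θ : ℝ, ‖f (a + Complex.exp (θ * Complex.I) • b)‖ ^ 2 ≤
        Real.exp (E + m * (h θ - (c - η))) := by
      intro θ
      have h1 := norm_sq_mul_volume_le_of_lintegral (m := m) (φ := φ) (ψ := logWeight a δ)
        (f := f) (U := Ω \ Metric.closedBall a R) (T := h θ) (q := q)
        (z := a + Complex.exp (θ * Complex.I) • b) (r := r)
        (fun y hy => ⟨hrΩ θ hy, fun hy' => by
          rw [mem_closedBall_iff_norm] at hy'
          linarith [(hdist θ y hy).1]⟩)
        (hf.mono (hrΩ θ)) (hle θ) (fun y hy => (logWeight_le hδ0 (hdist θ y hy).2).trans (by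
          have : δ ^ 2 ≤ 1 := by nlinarith
          rw [hq]; gcongr))
      have h2 := h1.trans (mul_le_mul_right hfint _)
      rw [hvol _ r hr, ← ENNReal.ofReal_mul (sq_nonneg _), ← ENNReal.ofReal_mul (Real.exp_nonneg _),
        ENNReal.ofReal_le_ofReal_iff (by positivity)] at h2
      have h3 : Real.exp (E + m * (h θ - (c - η))) = Real.exp (m * h θ + q) *
          ((C + 1) * Real.exp (-(m * (c - η)))) / (r ^ (2 * n) * V) := by
        rw [hE, show q + Real.log ((C + 1) / (r ^ (2 * n) * V)) + m * (h θ - (c - η)) =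
          (m * h θ + q) + (Real.log ((C + 1) / (r ^ (2 * n) * V)) + (-(m * (c - η)))) by ring,
          Real.exp_add (_ + _), Real.exp_add (Real.log _), Real.exp_log (by positivity)]
        ring
      rw [h3, le_div_iff₀ (by positivity)]
      refine h2.trans ?_
      gcongr
      linarith
    have hd : IntegrableOn (fun θ => (m : ℝ) * (h θ - (c - η))) (Ioc 0 (2 * Real.pi)) :=
      (hint.sub (integrable_const (c - η))).const_mul (m : ℝ)
    have hG : IntegrableOn (fun θ => E + m * (h θ - (c - η))) (Ioc 0 (2 * Real.pi)) :=
      (integrable_const E).add hd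
    have hJ := log_le_integral_of_norm_sq_le_exp hg (by simpa using hfa) hG hbound
    refine hJ.trans (le_of_eq ?_)
    have hvol2 : volume.real (Ioc 0 (2 * Real.pi)) = 2 * Real.pi := by
      rw [Real.volume_real_Ioc_of_le (by positivity), sub_zero]
    rw [integral_add (integrable_const E) hd,
      integral_const_mul, integral_sub hint (integrable_const _), setIntegral_const,
      setIntegral_const, hvol2]
    simp only [smul_eq_mul]
  by_contra hcon
  push Not at hcon
  obtain ⟨m, hm⟩ := exists_nat_gt ((2 * Real.pi * E - 2 * Real.pi * Real.log (1 / 4)) /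
    (2 * Real.pi * (c - η) - ∫ θ in Ioc 0 (2 * Real.pi), h θ))
  rw [div_lt_iff₀ (by linarith)] at hm
  -- The power must be positive, and passing to m + 1 only strengthens the contradiction.
  have h1 := hstep (m + 1) m.succ_pos
  push_cast at h1
  nlinarith

/-! ### Approximation of φ from above and passage to the limit -/

/-- The supremum of `φ` over balls of radius `r / (k + 1)` about the points of a curve, truncated
below at `-k`. -/
noncomputable def truncatedSup {n : ℕ} (φ : Cn n → EReal) (γ : ℝ → Cn n) (r : ℝ) (k : ℕ)
    (θ : ℝ) : EReal :=
  max (⨆ y ∈ Metric.ball (γ θ) (r / (k + 1)), φ y) ((-(k : ℝ) : ℝ) : EReal)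

/-- Suprema over moving open balls are lower semicontinuous, whatever φ is. -/
theorem measurable_truncatedSup {n : ℕ} (φ : Cn n → EReal) {γ : ℝ → Cn n} (hγ : Continuous γ)
    (r : ℝ) (k : ℕ) : Measurable (truncatedSup φ γ r k) := by
  refine Measurable.max (measurable_of_Ioi fun t => IsOpen.measurableSet ?_) measurable_const
  have : (fun θ => ⨆ y ∈ Metric.ball (γ θ) (r / (k + 1)), φ y) ⁻¹' Ioi t =
      ⋃ y ∈ {y | t < φ y}, γ ⁻¹' Metric.ball y (r / (k + 1)) := by
    ext θ
    simp only [mem_preimage, mem_Ioi, lt_iSup_iff, mem_iUnion, exists_prop, mem_ofPred_eq,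
      Metric.mem_ball']
    exact ⟨fun ⟨y, h1, h2⟩ => ⟨y, h2, by rwa [dist_comm]⟩,
      fun ⟨y, h1, h2⟩ => ⟨y, by rwa [dist_comm], h1⟩⟩
  rw [this]
  exact isOpen_biUnion fun y _ => Metric.isOpen_ball.preimage hγ

theorem antitone_truncatedSup {n : ℕ} (φ : Cn n → EReal) (γ : ℝ → Cn n) {r : ℝ} (hr : 0 < r)
    (θ : ℝ) : Antitone fun k => truncatedSup φ γ r k θ := by
  intro k l hkl
  have hkl' : (k : ℝ) ≤ l := by exact_mod_cast hkl
  refine max_le_max (biSup_mono fun y hy => ?_) (by exact_mod_cast neg_le_neg hkl')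
  exact Metric.ball_subset_ball (by gcongr) hy

/-- Each term is at least φ(γ θ); the upper bound is upper semicontinuity, with the truncation level
-k tending to -∞ to cover poles. -/
theorem tendsto_truncatedSup {n : ℕ} {Ω : Set (Cn n)} (hΩ : IsOpen Ω) {φ : Cn n → EReal}
    (husc : UpperSemicontinuousOn φ Ω) {γ : ℝ → Cn n} {r : ℝ} (hr : 0 < r) {θ : ℝ}
    (hθ : γ θ ∈ Ω) :
    Filter.Tendsto (fun k => truncatedSup φ γ r k θ) Filter.atTop (nhds (φ (γ θ))) := by
  refine tendsto_order.2 ⟨fun t ht => Filter.Eventually.of_forall fun k => ?_, fun t ht => ?_⟩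
  · refine ht.trans_le (le_max_of_le_left ?_)
    exact le_biSup φ (Metric.mem_ball_self (by positivity))
  · obtain ⟨t', ht1, ht2⟩ := exists_between ht
    have hnh : ∀ᶠ y in nhds (γ θ), φ y < t' := by
      have := husc (γ θ) hθ t' ht1
      rwa [hΩ.nhdsWithin_eq hθ] at this
    obtain ⟨ρ, hρ, hball⟩ := Metric.eventually_nhds_iff_ball.1 hnh
    have h1 : ∀ᶠ k : ℕ in Filter.atTop, r / (k + 1) < ρ := by
      have : Filter.Tendsto (fun k : ℕ => r * (1 / ((k : ℝ) + 1))) Filter.atTop (nhds (r * 0)) :=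
        tendsto_one_div_add_atTop_nhds_zero_nat.const_mul r
      rw [mul_zero] at this
      filter_upwards [this.eventually_lt_const hρ] with k hk
      rwa [mul_one_div] at hk
    have h2 : ∀ᶠ k : ℕ in Filter.atTop, ((-(k : ℝ) : ℝ) : EReal) < t := by
      have : Filter.Tendsto (fun k : ℕ => ((-(k : ℝ) : ℝ) : EReal)) Filter.atTop (nhds ⊥) :=
        EReal.tendsto_coe_nhds_bot_iff.2
          (Filter.tendsto_neg_atTop_atBot.comp tendsto_natCast_atTop_atTop)
      exact this.eventually_lt_const (bot_le.trans_lt ht)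
    filter_upwards [h1, h2] with k hk1 hk2
    refine max_lt (lt_of_le_of_lt (iSup₂_le fun y hy => ?_) ht2) hk2
    exact (hball y (Metric.ball_subset_ball hk1.le hy)).le

theorem coe_le_circleMean_of_twistedHormander {n : ℕ} {Ω : Set (Cn n)} (hΩ : IsOpen Ω)
    {φ : Cn n → EReal} (hlt : ∀ z ∈ Ω, φ z < ⊤) (husc : UpperSemicontinuousOn φ Ω)
    (hpole : IsClosed {z : Ω | φ z = ⊥}) (hholder : LocallyHolderOffPoles Ω φ)
    (hH : TwistedHormanderCondition Ω φ) {a b : Cn n} (hb : b ≠ 0)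
    (hdisc : ∀ ζ : ℂ, ‖ζ‖ ≤ 1 → a + ζ • b ∈ Ω) {c : ℝ} (hc : φ a = c) :
    (c : EReal) ≤ circleMean fun θ => φ (a + Complex.exp (θ * Complex.I) • b) := by
  have hpi := Real.pi_pos
  set γ : ℝ → Cn n := fun θ => a + Complex.exp (θ * Complex.I) • b with hγ
  have hγc : Continuous γ := by rw [hγ]; fun_prop
  have hmemK : ∀ θ : ℝ, γ θ ∈ (fun ζ : ℂ => a + ζ • b) '' Metric.closedBall 0 1 := fun θ =>
    ⟨Complex.exp (θ * Complex.I), by simp [Complex.norm_exp_ofReal_mul_I], rfl⟩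
  set K : Set (Cn n) := (fun ζ : ℂ => a + ζ • b) '' Metric.closedBall 0 1 with hK
  have hKc : IsCompact K := (isCompact_closedBall (0 : ℂ) 1).image (by fun_prop)
  have hKΩ : K ⊆ Ω := by
    rintro _ ⟨ζ, hζ, rfl⟩
    exact hdisc ζ (by simpa using hζ)
  obtain ⟨r₀, hr₀, hthick⟩ := hKc.exists_cthickening_subset_open hΩ hKΩ
  set r := min r₀ (‖b‖ / 2) with hr
  have hr0 : 0 < r := lt_min hr₀ (half_pos (norm_pos_iff.2 hb))
  have hballK : ∀ θ : ℝ, Metric.ball (γ θ) r ⊆ Metric.cthickening r₀ K := fun θ =>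
    (Metric.ball_subset_ball (min_le_left _ _)).trans
      ((Metric.ball_subset_thickening (hmemK θ) r₀).trans (Metric.thickening_subset_cthickening _ _))
  obtain ⟨x, hx, hxmax⟩ := (husc.mono hthick).exists_isMaxOn
    ⟨γ 0, hballK 0 (Metric.mem_ball_self hr0)⟩ (hKc.cthickening)
  -- The entries 0 and c provide 0 ≤ M and c ≤ M, required by `coe_le_circleMean`.
  set M : ℝ := max (max (φ x).toReal 0) c with hM
  have hM0 : 0 ≤ M := le_max_of_le_left (le_max_right _ _)
  have hcM : c ≤ M := le_max_right _ _
  have hφM : ∀ y ∈ Metric.cthickening r₀ K, φ y ≤ M := fun y hy => by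
    refine (hxmax hy).trans ((EReal.le_coe_toReal (hlt x (hthick hx)).ne).trans ?_)
    exact_mod_cast le_max_of_le_left (le_max_left _ _)
  have hradius : ∀ k : ℕ, 0 < r / (k + 1) ∧ r / (k + 1) ≤ r := fun k =>
    ⟨by positivity, div_le_self hr0.le (by linarith [(Nat.cast_nonneg k : (0 : ℝ) ≤ k)])⟩
  have hSM : ∀ k θ, truncatedSup φ γ r k θ ≤ M := fun k θ => by
    refine max_le (iSup₂_le fun y hy => hφM y (hballK θ
      (Metric.ball_subset_ball (hradius k).2 hy))) ?_
    exact_mod_cast (neg_nonpos.2 (Nat.cast_nonneg k)).trans hM0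
  have hSk : ∀ (k : ℕ) θ, ((-(k : ℝ) : ℝ) : EReal) ≤ truncatedSup φ γ r k θ := fun k θ =>
    le_max_right _ _
  have hScoe : ∀ k θ, ((truncatedSup φ γ r k θ).toReal : EReal) = truncatedSup φ γ r k θ :=
    fun k θ => EReal.coe_toReal ((hSM k θ).trans_lt (EReal.coe_lt_top M)).ne
      ((EReal.bot_lt_coe _).trans_le (hSk k θ)).ne'
  have hSmeas := fun k => measurable_truncatedSup φ hγc r k
  have htend : ∀ θ, Filter.Tendsto (fun k => truncatedSup φ γ r k θ) Filter.atTop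
      (nhds (φ (γ θ))) := fun θ => tendsto_truncatedSup hΩ husc hr0 (hKΩ (hmemK θ))
  have hmeas : Measurable fun θ => φ (γ θ) :=
    measurable_of_tendsto_metrizable hSmeas (tendsto_pi_nhds.2 htend)
  have hintegrable : ∀ k, IntegrableOn (fun θ => (truncatedSup φ γ r k θ).toReal)
      (Ioc 0 (2 * Real.pi)) := by
    intro k
    refine Measure.integrableOn_of_bounded (M := max M k) measure_Ioc_lt_top.ne
      (hSmeas k).ereal_toReal.aestronglyMeasurable (Filter.Eventually.of_forall fun θ => ?_)
    have h1 := hSM k θ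
    have h2 := hSk k θ
    rw [← hScoe, EReal.coe_le_coe_iff] at h1 h2
    rw [Real.norm_eq_abs, abs_le]
    exact ⟨by linarith [le_max_right M (k : ℝ)], h1.trans (le_max_left _ _)⟩
  have hle : ∀ k, ∫⁻ θ in Ioc 0 (2 * Real.pi), ((M : EReal) - truncatedSup φ γ r k θ).toENNReal ≤
      ENNReal.ofReal (2 * Real.pi * (M - c)) := by
    intro k
    have hmain := mul_le_integral_of_le_on_balls hΩ hH hb hdisc (c := c)
      (fun η R₁ hη hR₁ => exists_closedBall_near hΩ hlt hpole hholder
        (by simpa using hdisc 0 (by simp)) hc hη hR₁)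
      (hradius k).1 ((hradius k).2.trans (min_le_right _ _))
      (fun θ => (Metric.ball_subset_ball (hradius k).2).trans ((hballK θ).trans hthick))
      (hintegrable k) (fun θ y hy => by
        rw [hScoe]
        exact le_max_of_le_left (le_biSup φ hy))
    have heq : ∀ θ, ((M : EReal) - truncatedSup φ γ r k θ).toENNReal =
        ENNReal.ofReal (M - (truncatedSup φ γ r k θ).toReal) := fun θ => by
      rw [← hScoe k θ, ← EReal.coe_sub, EReal.real_coe_toENNReal, EReal.toReal_coe]
    simp only [heq]
    have hsub : IntegrableOn (fun θ => M - (truncatedSup φ γ r k θ).toReal)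
        (Ioc 0 (2 * Real.pi)) := (integrable_const M).sub (hintegrable k)
    rw [← ofReal_integral_eq_lintegral_ofReal hsub]
    · refine ENNReal.ofReal_le_ofReal ?_
      rw [integral_sub (integrable_const M) (hintegrable k), setIntegral_const,
        Real.volume_real_Ioc_of_le (by positivity), sub_zero, smul_eq_mul]
      linarith
    · refine Filter.Eventually.of_forall fun θ => ?_
      have h1 := hSM k θ
      rw [← hScoe, EReal.coe_le_coe_iff] at h1
      simpa using h1
  refine coe_le_circleMean hmeas hM0 hcM
    (fun θ => hφM _ (hballK θ (Metric.mem_ball_self hr0))) ?_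
  have hsub : ∀ x y : EReal, x ≤ y → ((M : EReal) - y).toENNReal ≤ ((M : EReal) - x).toENNReal :=
    fun x y hxy => EReal.toENNReal_le_toENNReal (EReal.sub_le_sub le_rfl hxy)
  -- Extended addition is continuous here because the summand M is finite.
  have hcont : Continuous fun x : EReal => ((M : EReal) - x).toENNReal := by
    refine EReal.continuous_toENNReal.comp (continuous_iff_continuousAt.2 fun x => ?_)
    have : ContinuousAt (fun p : EReal × EReal => p.1 + p.2) ((M : EReal), -x) :=
      EReal.continuousAt_add (by simp) (by simp)
    exact ContinuousAt.comp (f := fun x : EReal => ((M : EReal), -x)) this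
      (continuous_const.prodMk continuous_neg).continuousAt
  refine le_of_tendsto' (lintegral_tendsto_of_tendsto_of_monotone
    (fun k => (hcont.measurable.comp (hSmeas k)).aemeasurable)
    (Filter.Eventually.of_forall fun θ k l hkl => hsub _ _ (antitone_truncatedSup φ γ hr0 θ hkl))
    (Filter.Eventually.of_forall fun θ => (hcont.tendsto _).comp (htend θ))) hle

end TwistedHormander

theorem theorem1p1 (n : ℕ) (Ω : Set (TwistedHormander.Cn n))
    (hΩ_open : IsOpen Ω) (hΩ_conn : IsConnected Ω)
    (φ : TwistedHormander.Cn n → EReal)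
    (hφ_lt_top : ∀ z ∈ Ω, φ z < ⊤)
    (hφ_usc : UpperSemicontinuousOn φ Ω)
    (hφ_pole : IsClosed {z : Ω | φ z = ⊥})
    (hφ_holder : TwistedHormander.LocallyHolderOffPoles Ω φ)
    (hφ_hormander : TwistedHormander.TwistedHormanderCondition Ω φ) :
    TwistedHormander.IsPlurisubharmonic Ω φ := by
  refine ⟨hφ_lt_top, hφ_usc, fun a b hdisc => ?_⟩
  have ha : a ∈ Ω := by simpa using hdisc 0 (by simp)
  by_cases hbot : φ a = ⊥
  · rw [hbot]; exact bot_le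
  have hc : φ a = ((φ a).toReal : EReal) := (EReal.coe_toReal (hφ_lt_top a ha).ne hbot).symm
  -- For b = 0 the circle collapses to a and cannot be separated from the support of the cutoff.
  rcases eq_or_ne b 0 with rfl | hb
  · simp only [smul_zero, add_zero]
    rw [hc]
    exact TwistedHormander.coe_le_circleMean_const _
  · rw [hc]
    exact TwistedHormander.coe_le_circleMean_of_twistedHormander hΩ_open hφ_lt_top hφ_usc hφ_pole
      hφ_holder hφ_hormander hb hdisc hc
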